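/- Let $A\subset\mathbb{Z}^d\setminus\{0\}$ be a finite set whose cone $\mathbb{R}_{\ge 0}A$ is strongly convex (contains no line), let $\mathbb{N}A$ be the monoid of nonnegative integer combinations of elements of $A$, and let $\Bbbk[\mathbb{N}A]$ be its semigroup ring over a field $\Bbbk$. A subset $F\subseteq A$ is a face of $A$ if $\mathbb{R}_{\ge 0}F$ is a face of $\mathbb{R}_{\ge 0}A$ and $\mathbb{R}_{\ge 0}F\cap A=F$ (so $F=\varnothing$ is the face $\{0\}$). A pair of $A$ is $(a,F)$ with $a\in\mathbb{N}A$ and $F$ a face of $A$; write $(a,F)\prec(b,G)$ if $a+\mathbb{N}F\subseteq b+\mathbb{N}G$. For a monomial (that is, $\mathbb{Z}^d$-homogeneous) ideal $I\subseteq\Bbbk[\mathbb{N}A]$, let $\mathrm{stdMono}(I)=\{a\in\mathbb{N}A : t^a\notin I\}$. A proper pair of $I$ is a pair $(a,F)$ of $A$ with $a+\mathbb{N}F\subseteq\mathrm{stdMono}(I)$; a standard pair of $I$ is a proper pair of $I$ that is maximal with respect to $\prec$. A cover of the standard monomials of $I$ is a finite set $C$ of pairs of $A$ with $\mathrm{stdMono}(I)=\bigcup_{(a,F)\in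 C}(a+\mathbb{N}F)$. Proposition. There is an algorithm whose input is a configuration $A$ as above together with a cover $C$ of the standard monomials of a monomial ideal $I$ of $\Bbbk[\mathbb{N}A]$ (the sets $A$ and $C$ being given as finite lists of integer data), and which terminates on every such input and outputs the (finite) set of standard pairs of $I$. The algorithm is a single one: it depends neither on $I$, nor on $\Bbbk$, nor on $A$. -/

import Mathlib

universe u

namespace StdPairs

/-- The affine semigroup `ℕA`: all nonnegative integer combinations of the elements of `A`. -/
abbrev natSpan {d : ℕ} (A : Finset (Fin d → ℤ)) : AddSubmonoid (Fin d → ℤ) :=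
  AddSubmonoid.closure (A : Set (Fin d → ℤ))

/-- The cone `ℝ≥0 A` in `ℝ^d`. -/
noncomputable def cone {d : ℕ} (A : Finset (Fin d → ℤ)) : PointedCone ℝ (Fin d → ℝ) :=
  PointedCone.hull ℝ ((fun (v : Fin d → ℤ) (i : Fin d) => (v i : ℝ)) '' (A : Set (Fin d → ℤ)))

/-- The cone `ℝ≥0 A` is strongly convex: it contains no line through the origin. -/
def StronglyConvex {d : ℕ} (A : Finset (Fin d → ℤ)) : Prop :=
  (cone A : ConvexCone ℝ (Fin d → ℝ)).Salient

/-- `F ⊆ A` is a face of `A`: `ℝ≥0 F` is a face of `ℝ≥0 A`, and `ℝ≥0 F ∩ A = F`. -/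
def IsFace {d : ℕ} (A F : Finset (Fin d → ℤ)) : Prop :=
  F ⊆ A ∧ (cone F).IsFaceOf (cone A) ∧
    ∀ v ∈ A, (fun i => (v i : ℝ)) ∈ cone F → v ∈ F

/-- The underlying data of a pair `(a, F)`. -/
abbrev Pair (d : ℕ) : Type := (Fin d → ℤ) × Finset (Fin d → ℤ)

/-- `(a, F)` is a pair of `A`: `a ∈ ℕA` and `F` is a face of `A`. -/
def IsPair {d : ℕ} (A : Finset (Fin d → ℤ)) (p : Pair d) : Prop :=
  p.1 ∈ natSpan A ∧ IsFace A p.2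

/-- The set `a + ℕF` attached to `(a, F)`. -/
def region {d : ℕ} (p : Pair d) : Set (Fin d → ℤ) :=
  {b | ∃ c ∈ natSpan p.2, b = p.1 + c}

/-- `(a, F) ≺ (b, G)`: `a + ℕF ⊆ b + ℕG` (equality allowed). -/
def Prec {d : ℕ} (p q : Pair d) : Prop := region p ⊆ region q

/-- The semigroup ring `𝕜[ℕA]`. -/
abbrev SemigroupRing (𝕜 : Type u) [Field 𝕜] {d : ℕ} (A : Finset (Fin d → ℤ)) : Type u :=
  AddMonoidAlgebra 𝕜 (natSpan A)

/-- Monomial ideals: the ideals that are homogeneous for the `ℤ^d`-grading `deg (t^a) = a`. -/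
def IsMonomialIdeal {𝕜 : Type u} [Field 𝕜] {d : ℕ} {A : Finset (Fin d → ℤ)}
    (I : Ideal (SemigroupRing 𝕜 A)) : Prop :=
  I.IsHomogeneous (AddMonoidAlgebra.gradeBy 𝕜 (natSpan A).subtype)

/-- The (exponents of the) standard monomials of `I`: those `a ∈ ℕA` with `t^a ∉ I`. -/
def stdMono {𝕜 : Type u} [Field 𝕜] {d : ℕ} {A : Finset (Fin d → ℤ)}
    (I : Ideal (SemigroupRing 𝕜 A)) : Set (Fin d → ℤ) :=
  {a | ∃ h : a ∈ natSpan A, AddMonoidAlgebra.single (⟨a, h⟩ : natSpan A) (1 : 𝕜) ∉ I}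

/-- Proper pairs of `I`: pairs `(a, F)` of `A` with `a + ℕF ⊆ stdMono I`. -/
def IsProperPair {𝕜 : Type u} [Field 𝕜] {d : ℕ} {A : Finset (Fin d → ℤ)}
    (I : Ideal (SemigroupRing 𝕜 A)) (p : Pair d) : Prop :=
  IsPair A p ∧ region p ⊆ stdMono I

/-- The standard pairs of `I`: the proper pairs of `I` that are maximal with respect to `≺`. -/
def stdPairs {𝕜 : Type u} [Field 𝕜] {d : ℕ} {A : Finset (Fin d → ℤ)}
    (I : Ideal (SemigroupRing 𝕜 A)) : Set (Pair d) :=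
  {p | IsProperPair I p ∧ ∀ q, IsProperPair I q → Prec p q → q = p}

/-- A finite collection `C` of pairs of `A` is a cover of the standard monomials of `I` if the
sets `a + ℕF`, for `(a, F) ∈ C`, have union `stdMono I`. -/
def IsCover {𝕜 : Type u} [Field 𝕜] {d : ℕ} {A : Finset (Fin d → ℤ)}
    (I : Ideal (SemigroupRing 𝕜 A)) (C : Finset (Pair d)) : Prop :=
  (∀ p ∈ C, IsPair A p) ∧ stdMono I = ⋃ p ∈ C, region p

/-- A finite set of vectors as finite data: a list of integer vectors, each one written as the
list of its coordinates. -/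
abbrev VecListCode : Type := List (List ℤ)

/-- A finite set of pairs as finite data: each pair `(a, F)` is written as the coordinate list of
`a` together with a list of the elements of `F`. -/
abbrev PairListCode : Type := List (List ℤ × VecListCode)

/-- `l` lists the elements of `S` (in any order, repetitions allowed), where `R x y` means that
`x` is a code of `y`. -/
def Lists {α β : Type} (R : α → β → Prop) (l : List α) (S : Set β) : Prop :=
  (∀ x ∈ l, ∃ y ∈ S, R x y) ∧ ∀ y ∈ S, ∃ x ∈ l, R x y

/-- `l` is the coordinate list of the vector `v`. -/
def CodesVec {d : ℕ} (l : List ℤ) (v : Fin d → ℤ) : Prop := l = List.ofFn v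

/-- `l` is a list of the elements of the set of vectors `S`. -/
def CodesVecs {d : ℕ} (l : VecListCode) (S : Finset (Fin d → ℤ)) : Prop :=
  Lists CodesVec l (S : Set (Fin d → ℤ))

/-- `x` is a code of the pair `p`. -/
def CodesPair {d : ℕ} (x : List ℤ × VecListCode) (p : Pair d) : Prop :=
  CodesVec x.1 p.1 ∧ CodesVecs x.2 p.2

/-- `l` is a list of the elements of the set of pairs `S`. -/
def CodesPairs {d : ℕ} (l : PairListCode) (S : Set (Pair d)) : Prop :=
  Lists CodesPair l S

end StdPairs

/-! A face of `A` is cut out by an integer functional that vanishes on it and is positive on the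
rest of `A` (`IsFace.exists_functional`). For the empty face this is a functional φ positive on all
of `A`; it bounds the number of summands and so makes membership in b + ℕG decidable.

Properness of a pair (a, F) is decided by searching both ways. If it is proper, pigeonhole on the
points a + N·s, with s the sum of F, puts two of them in one set b + ℕG of the cover, and this
forces F ⊆ G (`IsCover.exists_add_mem`). Conversely, F ⊆ G and a single f ∈ ℕF with a + f ∈ b + ℕG
certify properness, because divisors of standard monomials are standard
(`IsCover.isProperPair_of_add_mem`). If the pair is not proper, some point of a + ℕF escapes the
cover.

Only finitely many pairs compete for maximality. Every proper pair lies below a proper (m, G) with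
(b, G) in the cover, m ∈ ℕ(A \ G), and l·m = l·b for every l vanishing on G (`IsCover.exists_prec`);
taking l to expose G bounds the number of summands of m. The bounds and functionals needed form a
certificate whose validity is primitive recursive, and the algorithm searches for one: a valid
certificate exists (`exists_valid`), and every valid one yields the standard pairs
(`codesPairs_output`). -/

namespace StdPairs

/-! ### Primitive recursive operations on lists and integers. -/

section Primrec

variable {α β γ : Type*} [Primcodable α] [Primcodable β] [Primcodable γ]

theorem primrecPred_exists_mem {f : α → List β} {p : α → β → Prop} (hf : Primrec f)
    (hp : PrimrecRel p) : PrimrecPred fun a => ∃ b ∈ f a, p a b :=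
  (PrimrecRel.exists_mem_list hp.swap).comp hf .id

theorem primrecPred_forall_mem {f : α → List β} {p : α → β → Prop} (hf : Primrec f)
    (hp : PrimrecRel p) : PrimrecPred fun a => ∀ b ∈ f a, p a b :=
  (PrimrecRel.forall_mem_list hp.swap).comp hf .id

theorem primrecPred_mem {f : α → List β} {g : α → β} (hf : Primrec f) (hg : Primrec g) :
    PrimrecPred fun a => g a ∈ f a :=
  (primrecPred_exists_mem hf (p := fun a b => b = g a)
    (Primrec.eq.comp .snd (hg.comp .fst))).of_eq fun a => by simp

theorem primrecPred_subset {f g : α → List β} (hf : Primrec f) (hg : Primrec g) :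
    PrimrecPred fun a => f a ⊆ g a :=
  (primrecPred_forall_mem hf (p := fun a b => b ∈ g a)
    (primrecPred_mem (hg.comp .fst) .snd)).of_eq fun _ => Iff.rfl

theorem primrecPred_imp {p q : α → Prop} (hp : PrimrecPred p) (hq : PrimrecPred q) :
    PrimrecPred fun a => p a → q a :=
  (hp.not.or hq).of_eq fun _ => by tauto

theorem primrec_listFilter {f : α → List β} {p : α → β → Prop} [∀ a, DecidablePred (p a)]
    (hf : Primrec f) (hp : PrimrecRel p) : Primrec fun a => (f a).filter (p a ·) := by
  have h : Primrec₂ fun (a : α) (b : β) => if p a b then some b else none :=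
    Primrec.ite hp (Primrec.option_some.comp .snd) (.const none)
  refine (Primrec.listFilterMap hf h).of_eq fun a => ?_
  rw [← List.filterMap_eq_filter]
  congr 1
  funext b
  simp [Option.guard]

theorem primrec_zipWith {f : α → β → γ} (hf : Primrec₂ f) :
    Primrec₂ fun (l : List α) (m : List β) => List.zipWith f l m := by
  have hg : Primrec₂ fun (t : List α × List β) (i : ℕ) =>
      t.1[i]?.bind fun a => t.2[i]?.map fun b => f a b := by
    refine Primrec.option_bind
      (Primrec.list_getElem?.comp (Primrec.fst.comp .fst) .snd) ?_
    refine Primrec.option_map (Primrec.list_getElem?.comp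
      (Primrec.snd.comp (Primrec.fst.comp .fst)) (Primrec.snd.comp .fst)) ?_
    exact hf.comp (Primrec.snd.comp .fst) .snd
  refine (Primrec.listFilterMap (Primrec.list_range.comp (Primrec.list_length.comp .fst))
    hg).of_eq fun t => ?_
  obtain ⟨l, m⟩ := t
  induction l generalizing m with
  | nil => simp
  | cons a l ih =>
    cases m with
    | nil => simp
    | cons b m =>
      simp only [List.length_cons, List.range_succ_eq_map, List.filterMap_cons,
        List.filterMap_map, List.zipWith_cons_cons] at ih ⊢
      simpa [Function.comp_def] using ih m

/-- The encoding of ℤ sends n to 2n and -(n + 1) to 2n + 1. Through it, integer arithmetic reduces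
to arithmetic on the positive and negative parts in ℕ. -/
theorem encode_int_sub (m n : ℕ) :
    Encodable.encode ((m : ℤ) - n) = if n ≤ m then 2 * (m - n) else 2 * (n - m - 1) + 1 := by
  split_ifs with h
  · obtain ⟨k, rfl⟩ := Nat.exists_eq_add_of_le h
    have : ((n + k : ℕ) : ℤ) - n = (k : ℤ) := by push_cast; ring
    rw [this, Nat.add_sub_cancel_left]
    rfl
  · obtain ⟨k, rfl⟩ := Nat.exists_eq_add_of_lt (not_le.mp h)
    have : (m : ℤ) - ((m + k + 1 : ℕ) : ℤ) = Int.negSucc k := by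
      rw [Int.negSucc_eq]; push_cast; ring
    rw [this, show m + k + 1 - m - 1 = k by omega]
    rfl

theorem primrec_natSub : Primrec₂ fun m n : ℕ => (m : ℤ) - n := by
  have h : Primrec fun t : ℕ × ℕ =>
      if t.2 ≤ t.1 then 2 * (t.1 - t.2) else 2 * (t.2 - t.1 - 1) + 1 := by
    refine Primrec.ite (Primrec.nat_le.comp .snd .fst)
      (Primrec.nat_mul.comp (.const 2) (Primrec.nat_sub.comp .fst .snd))
      (Primrec.succ.comp (Primrec.nat_mul.comp (.const 2) (Primrec.nat_sub.comp
        (Primrec.nat_sub.comp .snd .fst) (.const 1))))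
  exact Primrec.encode_iff.mp (h.of_eq fun t => (encode_int_sub t.1 t.2).symm)

theorem toNat_eq_encode (z : ℤ) :
    z.toNat = if Encodable.encode z % 2 = 0 then Encodable.encode z / 2 else 0 := by
  cases z with
  | ofNat n =>
    have : Encodable.encode (Int.ofNat n) = 2 * n := rfl
    rw [this]; simp
  | negSucc n =>
    have : Encodable.encode (Int.negSucc n) = 2 * n + 1 := rfl
    rw [this, if_neg (by omega)]; rfl

theorem neg_toNat_eq_encode (z : ℤ) :
    (-z).toNat = if Encodable.encode z % 2 = 0 then 0 else Encodable.encode z / 2 + 1 := by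
  cases z with
  | ofNat n =>
    have : Encodable.encode (Int.ofNat n) = 2 * n := rfl
    rw [this]; simp
  | negSucc n =>
    have : Encodable.encode (Int.negSucc n) = 2 * n + 1 := rfl
    rw [this, if_neg (by omega), Int.neg_negSucc, Int.toNat_natCast]; omega

theorem primrec_toNat : Primrec Int.toNat := by
  have h : Primrec fun z : ℤ =>
      if Encodable.encode z % 2 = 0 then Encodable.encode z / 2 else 0 :=
    Primrec.ite (Primrec.eq.comp (Primrec.nat_mod.comp .encode (.const 2)) (.const 0))
      (Primrec.nat_div.comp .encode (.const 2)) (.const 0)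
  exact h.of_eq fun z => (toNat_eq_encode z).symm

theorem primrec_neg_toNat : Primrec fun z : ℤ => (-z).toNat := by
  have h : Primrec fun z : ℤ =>
      if Encodable.encode z % 2 = 0 then 0 else Encodable.encode z / 2 + 1 :=
    Primrec.ite (Primrec.eq.comp (Primrec.nat_mod.comp .encode (.const 2)) (.const 0))
      (.const 0) (Primrec.succ.comp (Primrec.nat_div.comp .encode (.const 2)))
  exact h.of_eq fun z => (neg_toNat_eq_encode z).symm

theorem primrec_intAdd : Primrec₂ fun x y : ℤ => x + y := by
  have h : Primrec₂ fun x y : ℤ =>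
      ((x.toNat + y.toNat : ℕ) : ℤ) - ((-x).toNat + (-y).toNat : ℕ) :=
    primrec_natSub.comp
      (Primrec.nat_add.comp (primrec_toNat.comp .fst) (primrec_toNat.comp .snd))
      (Primrec.nat_add.comp (primrec_neg_toNat.comp .fst) (primrec_neg_toNat.comp .snd))
  exact h.of_eq fun x y => by push_cast; omega

theorem primrec_intMul : Primrec₂ fun x y : ℤ => x * y := by
  have h : Primrec₂ fun x y : ℤ =>
      ((x.toNat * y.toNat + (-x).toNat * (-y).toNat : ℕ) : ℤ) -
        (x.toNat * (-y).toNat + (-x).toNat * y.toNat : ℕ) :=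
    primrec_natSub.comp
      (Primrec.nat_add.comp
        (Primrec.nat_mul.comp (primrec_toNat.comp .fst) (primrec_toNat.comp .snd))
        (Primrec.nat_mul.comp (primrec_neg_toNat.comp .fst) (primrec_neg_toNat.comp .snd)))
      (Primrec.nat_add.comp
        (Primrec.nat_mul.comp (primrec_toNat.comp .fst) (primrec_neg_toNat.comp .snd))
        (Primrec.nat_mul.comp (primrec_neg_toNat.comp .fst) (primrec_toNat.comp .snd)))
  refine h.of_eq fun x y => ?_
  have hx : x = (x.toNat : ℤ) - ((-x).toNat : ℤ) := by omega
  have hy : y = (y.toNat : ℤ) - ((-y).toNat : ℤ) := by omega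
  conv_rhs => rw [hx, hy]
  push_cast
  ring

end Primrec

/-! ### Certificates and the computation from a certificate. -/

/-- The sum of two vectors given by their coordinate lists. -/
def vecAdd (u v : List ℤ) : List ℤ := List.zipWith (· + ·) u v

/-- The standard bilinear form on coordinate lists. -/
def dot (l v : List ℤ) : ℤ := (List.zipWith (· * ·) l v).foldr (· + ·) 0

/-- The vectors obtained from `b` by adding at most `k` elements of `G`. -/
def reach (G : VecListCode) (b : List ℤ) : ℕ → VecListCode
  | 0 => [b]
  | k + 1 => reach G b k ++ (reach G b k).flatMap fun x => G.map (vecAdd x)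

/-- The test of `x ∈ b + ℕG` by means of the functional `φ`, taken to be positive on `G`. -/
def MemShift (φ x b : List ℤ) (G : VecListCode) : Prop := x ∈ reach G b (dot φ x).toNat

/-- The pairs `(m, G)` with `G` the face of a pair in `C` and `m` a sum of at most `k` elements
of `A`. -/
def candidates (A : VecListCode) (C : PairListCode) (k : ℕ) : PairListCode :=
  C.flatMap fun p => (reach A (p.1.map fun _ => 0) k).map fun m => (m, p.2)

/-- Evidence, found within `k` steps, that the pair coded by `x` is proper. -/
def ProperWit (φ : List ℤ) (C : PairListCode) (k : ℕ) (x : List ℤ × VecListCode) : Prop :=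
  ∃ y ∈ reach x.2 x.1 k, ∃ p ∈ C, x.2 ⊆ p.2 ∧ MemShift φ y p.1 p.2

/-- Evidence, found within `k` steps, that the pair coded by `x` is not proper. -/
def ImproperWit (φ : List ℤ) (C : PairListCode) (k : ℕ) (x : List ℤ × VecListCode) : Prop :=
  ∃ y ∈ reach x.2 x.1 k, ¬ ∃ p ∈ C, MemShift φ y p.1 p.2

/-- A size bound for the candidates, a search bound for the evidence, a functional that is positive on `A`, and functionals that expose the
faces of the pairs of a cover. -/
abbrev Certificate : Type := ℕ × ℕ × List ℤ × VecListCode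

/-- The functional `l` vanishes on the face `G` and is positive on the rest of `A`. -/
def Exposes (A : VecListCode) (l : List ℤ) (G : VecListCode) : Prop :=
  ∀ v ∈ A, v ∈ G ∧ dot l v = 0 ∨ v ∉ G ∧ 0 < (dot l v).toNat

/-- The certificate `Z` is valid for the configuration `A` and the cover `C`. -/
def Valid (A : VecListCode) (C : PairListCode) (Z : Certificate) : Prop :=
  (∀ v ∈ A, 0 < (dot Z.2.2.1 v).toNat) ∧
  (∀ p ∈ C, ∃ l ∈ Z.2.2.2, Exposes A l p.2 ∧ (dot l p.1).toNat ≤ Z.1) ∧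
  ∀ x ∈ candidates A C Z.1, ProperWit Z.2.2.1 C Z.2.1 x ∨ ImproperWit Z.2.2.1 C Z.2.1 x

/-- The pair coded by `x` is, as far as the certificate `Z` tells, a proper pair that is maximal
among the proper candidates. -/
def Selected (A : VecListCode) (C : PairListCode) (Z : Certificate)
    (x : List ℤ × VecListCode) : Prop :=
  ProperWit Z.2.2.1 C Z.2.1 x ∧ ∀ q ∈ candidates A C Z.1, ProperWit Z.2.2.1 C Z.2.1 q →
    x.2 ⊆ q.2 ∧ MemShift Z.2.2.1 x.1 q.1 q.2 → q.1 = x.1 ∧ q.2 ⊆ x.2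

open scoped Classical in
/-- The standard pairs, as computed from a valid certificate. -/
noncomputable def output (A : VecListCode) (C : PairListCode) (Z : Certificate) : PairListCode :=
  (candidates A C Z.1).filter (Selected A C Z ·)

/-! ### Checking a certificate is primitive recursive; the search. -/

section Primrec

variable {α : Type*} [Primcodable α]

theorem primrec_vecAdd : Primrec₂ vecAdd := primrec_zipWith primrec_intAdd

theorem primrec_dot : Primrec₂ dot :=
  Primrec.list_foldr (primrec_zipWith primrec_intMul) (.const 0)
    (primrec_intAdd.comp (Primrec.fst.comp .snd) (Primrec.snd.comp .snd)).to₂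

theorem primrec_reach {f : α → VecListCode} {g : α → List ℤ} {h : α → ℕ} (hf : Primrec f)
    (hg : Primrec g) (hh : Primrec h) : Primrec fun a => reach (f a) (g a) (h a) := by
  have hs : Primrec₂ fun (a : α) (t : ℕ × VecListCode) =>
      t.2 ++ t.2.flatMap fun x => (f a).map (vecAdd x) := by
    refine Primrec.list_append.comp (Primrec.snd.comp .snd)
      (Primrec.list_flatMap (Primrec.snd.comp .snd) ?_)
    exact Primrec.list_map (hf.comp (Primrec.fst.comp .fst))
      (primrec_vecAdd.comp (Primrec.snd.comp .fst) .snd)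
  have h0 : Primrec fun a => [g a] := Primrec.list_cons.comp hg (.const [])
  refine (Primrec.nat_rec' hh h0 hs).of_eq fun a => ?_
  induction h a with
  | zero => rfl
  | succ k ih => simp only [reach, ← ih]

theorem primrecPred_memShift {φ x b : α → List ℤ} {G : α → VecListCode} (hφ : Primrec φ)
    (hx : Primrec x) (hb : Primrec b) (hG : Primrec G) :
    PrimrecPred fun a => MemShift (φ a) (x a) (b a) (G a) :=
  primrecPred_mem (primrec_reach hG hb (primrec_toNat.comp (primrec_dot.comp hφ hx))) hx

theorem primrec_candidates {A : α → VecListCode} {C : α → PairListCode} {k : α → ℕ}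
    (hA : Primrec A) (hC : Primrec C) (hk : Primrec k) :
    Primrec fun a => candidates (A a) (C a) (k a) := by
  refine Primrec.list_flatMap hC ?_
  refine Primrec.list_map (primrec_reach (hA.comp .fst) ?_ (hk.comp .fst)) ?_
  · exact Primrec.list_map (Primrec.fst.comp .snd) (.const 0)
  · exact Primrec.pair .snd (Primrec.snd.comp (Primrec.snd.comp .fst))

theorem primrecPred_properWit {φ : α → List ℤ} {C : α → PairListCode} {k : α → ℕ}
    {x : α → List ℤ × VecListCode} (hφ : Primrec φ) (hC : Primrec C) (hk : Primrec k)
    (hx : Primrec x) : PrimrecPred fun a => ProperWit (φ a) (C a) (k a) (x a) := by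
  refine primrecPred_exists_mem
    (primrec_reach (Primrec.snd.comp hx) (Primrec.fst.comp hx) hk) ?_
  refine primrecPred_exists_mem (hC.comp .fst) ?_
  refine (primrecPred_subset ?_ (Primrec.snd.comp .snd)).and
    (primrecPred_memShift ?_ (Primrec.snd.comp .fst) (Primrec.fst.comp .snd)
      (Primrec.snd.comp .snd))
  · exact Primrec.snd.comp (hx.comp (Primrec.fst.comp .fst))
  · exact hφ.comp (Primrec.fst.comp .fst)

theorem primrecPred_improperWit {φ : α → List ℤ} {C : α → PairListCode} {k : α → ℕ}
    {x : α → List ℤ × VecListCode} (hφ : Primrec φ) (hC : Primrec C) (hk : Primrec k)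
    (hx : Primrec x) : PrimrecPred fun a => ImproperWit (φ a) (C a) (k a) (x a) := by
  refine primrecPred_exists_mem
    (primrec_reach (Primrec.snd.comp hx) (Primrec.fst.comp hx) hk) ?_
  refine PrimrecPred.not (primrecPred_exists_mem (hC.comp .fst) ?_)
  exact primrecPred_memShift (hφ.comp (Primrec.fst.comp .fst)) (Primrec.snd.comp .fst)
    (Primrec.fst.comp .snd) (Primrec.snd.comp .snd)

theorem primrecPred_exposes {A : α → VecListCode} {l : α → List ℤ} {G : α → VecListCode}
    (hA : Primrec A) (hl : Primrec l) (hG : Primrec G) :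
    PrimrecPred fun a => Exposes (A a) (l a) (G a) := by
  have hm : PrimrecPred fun t : α × List ℤ => t.2 ∈ G t.1 :=
    primrecPred_mem (hG.comp .fst) .snd
  have hd : Primrec fun t : α × List ℤ => dot (l t.1) t.2 :=
    primrec_dot.comp (hl.comp .fst) .snd
  exact primrecPred_forall_mem hA ((hm.and (Primrec.eq.comp hd (.const 0))).or
    (hm.not.and (Primrec.nat_lt.comp (.const 0) (primrec_toNat.comp hd))))

theorem primrecPred_valid {A : α → VecListCode} {C : α → PairListCode} {Z : α → Certificate}
    (hA : Primrec A) (hC : Primrec C) (hZ : Primrec Z) :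
    PrimrecPred fun a => Valid (A a) (C a) (Z a) := by
  have hN : Primrec fun a => (Z a).1 := Primrec.fst.comp hZ
  have hk : Primrec fun a => (Z a).2.1 := Primrec.fst.comp (Primrec.snd.comp hZ)
  have hφ : Primrec fun a => (Z a).2.2.1 :=
    Primrec.fst.comp (Primrec.snd.comp (Primrec.snd.comp hZ))
  have hΛ : Primrec fun a => (Z a).2.2.2 :=
    Primrec.snd.comp (Primrec.snd.comp (Primrec.snd.comp hZ))
  refine PrimrecPred.and ?_ (PrimrecPred.and ?_ ?_)
  · exact primrecPred_forall_mem hA (Primrec.nat_lt.comp (.const 0)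
      (primrec_toNat.comp (primrec_dot.comp (hφ.comp .fst) .snd)))
  · refine primrecPred_forall_mem hC (primrecPred_exists_mem (hΛ.comp .fst) ?_)
    exact (primrecPred_exposes (hA.comp (Primrec.fst.comp .fst)) .snd
      (Primrec.snd.comp (Primrec.snd.comp .fst))).and
      (Primrec.nat_le.comp (primrec_toNat.comp
        (primrec_dot.comp .snd (Primrec.fst.comp (Primrec.snd.comp .fst))))
        (hN.comp (Primrec.fst.comp .fst)))
  · exact primrecPred_forall_mem (primrec_candidates hA hC hN)
      ((primrecPred_properWit (hφ.comp .fst) (hC.comp .fst) (hk.comp .fst) .snd).or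
        (primrecPred_improperWit (hφ.comp .fst) (hC.comp .fst) (hk.comp .fst) .snd))

theorem primrecPred_selected {A : α → VecListCode} {C : α → PairListCode}
    {Z : α → Certificate} {x : α → List ℤ × VecListCode}
    (hA : Primrec A) (hC : Primrec C) (hZ : Primrec Z) (hx : Primrec x) :
    PrimrecPred fun a => Selected (A a) (C a) (Z a) (x a) := by
  have hN : Primrec fun a => (Z a).1 := Primrec.fst.comp hZ
  have hk : Primrec fun a => (Z a).2.1 := Primrec.fst.comp (Primrec.snd.comp hZ)
  have hφ : Primrec fun a => (Z a).2.2.1 :=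
    Primrec.fst.comp (Primrec.snd.comp (Primrec.snd.comp hZ))
  have hx₁ : Primrec fun a => (x a).1 := Primrec.fst.comp hx
  have hx₂ : Primrec fun a => (x a).2 := Primrec.snd.comp hx
  refine (primrecPred_properWit hφ hC hk hx).and
    (primrecPred_forall_mem (primrec_candidates hA hC hN) ?_)
  refine primrecPred_imp
    (primrecPred_properWit (hφ.comp .fst) (hC.comp .fst) (hk.comp .fst) .snd) ?_
  refine primrecPred_imp ((primrecPred_subset (hx₂.comp .fst) (Primrec.snd.comp .snd)).and
    (primrecPred_memShift (hφ.comp .fst) (hx₁.comp .fst) (Primrec.fst.comp .snd)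
      (Primrec.snd.comp .snd))) ?_
  exact (Primrec.eq.comp (Primrec.fst.comp .snd) (hx₁.comp .fst)).and
    (primrecPred_subset (Primrec.snd.comp .snd) (hx₂.comp .fst))

theorem primrec_output {A : α → VecListCode} {C : α → PairListCode} {Z : α → Certificate}
    (hA : Primrec A) (hC : Primrec C) (hZ : Primrec Z) :
    Primrec fun a => output (A a) (C a) (Z a) := by
  classical
  have := primrec_listFilter (p := fun a x => Selected (A a) (C a) (Z a) x)
    (primrec_candidates hA hC (Primrec.fst.comp hZ))
    (primrecPred_selected (hA.comp .fst) (hC.comp .fst) (hZ.comp .fst) .snd)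
  exact this.of_eq fun a => by unfold output; congr

end Primrec

/-- Search for a valid certificate, and compute the output from the first one found. -/
theorem exists_partrec_search :
    ∃ alg : VecListCode × PairListCode →. PairListCode, Partrec alg ∧
      ∀ A C, (∃ Z, Valid A C Z) → ∃ Z, Valid A C Z ∧ output A C Z ∈ alg (A, C) := by
  classical
  let step : VecListCode × PairListCode → ℕ → Option PairListCode := fun t n =>
    (Encodable.decode (α := Certificate) n).bind fun Z =>
      if Valid t.1 t.2 Z then some (output t.1 t.2 Z) else none
  have hstep : Primrec₂ step := by
    refine Primrec.option_bind (Primrec.decode.comp .snd) ?_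
    have hA : Primrec fun s : ((VecListCode × PairListCode) × ℕ) × Certificate => s.1.1.1 :=
      Primrec.fst.comp (Primrec.fst.comp .fst)
    have hC : Primrec fun s : ((VecListCode × PairListCode) × ℕ) × Certificate => s.1.1.2 :=
      Primrec.snd.comp (Primrec.fst.comp .fst)
    exact Primrec.ite (primrecPred_valid hA hC .snd)
      (Primrec.option_some.comp (primrec_output hA hC .snd)) (.const none)
  refine ⟨fun t => Nat.rfindOpt (step t), Partrec.rfindOpt hstep.to_comp, ?_⟩
  rintro A C ⟨Z, hZ⟩
  have hdom : (Nat.rfindOpt (step (A, C))).Dom :=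
    Nat.rfindOpt_dom.mpr ⟨Encodable.encode Z, output A C Z, by
      simp only [step, Encodable.encodek, Option.bind_some, if_pos hZ, Option.mem_def]⟩
  obtain ⟨o, ho⟩ := Part.dom_iff_mem.mp hdom
  obtain ⟨n, hn⟩ := Nat.rfindOpt_spec ho
  simp only [step, Option.mem_def, Option.bind_eq_some_iff] at hn
  obtain ⟨Z', -, h⟩ := hn
  split_ifs at h with hv
  exact ⟨Z', hv, by rw [Option.some.inj h]; exact ho⟩

/-! ### Exposing faces by integer functionals. -/

/-- A negative coefficient is moved to the other side. This lets the face property, which concerns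
the cone of `F`, control its linear span. -/
theorem exists_sub_of_mem_span {d : ℕ} {F : Finset (Fin d → ℤ)} {x : Fin d → ℝ}
    (hx : x ∈ Submodule.span ℝ
      ((fun (v : Fin d → ℤ) (i : Fin d) => (v i : ℝ)) '' (F : Set (Fin d → ℤ)))) :
    ∃ p ∈ cone F, ∃ q ∈ cone F, x + q = p := by
  induction hx using Submodule.span_induction with
  | mem x hx => exact ⟨x, PointedCone.subset_hull hx, 0, zero_mem _, add_zero x⟩
  | zero => exact ⟨0, zero_mem _, 0, zero_mem _, add_zero 0⟩
  | add x y _ _ hx hy =>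
    obtain ⟨p, hp, q, hq, h⟩ := hx
    obtain ⟨p', hp', q', hq', h'⟩ := hy
    exact ⟨p + p', add_mem hp hp', q + q', add_mem hq hq', by rw [← h, ← h']; abel⟩
  | smul c x _ hx =>
    obtain ⟨p, hp, q, hq, h⟩ := hx
    rcases le_total 0 c with hc | hc
    · exact ⟨c • p, PointedCone.smul_mem _ hc hp, c • q, PointedCone.smul_mem _ hc hq, by
        rw [← h, smul_add]⟩
    · refine ⟨(-c) • q, PointedCone.smul_mem _ (by linarith) hq, (-c) • p,
        PointedCone.smul_mem _ (by linarith) hp, ?_⟩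
      rw [← h]; module

/-- A face of a polyhedral cone is exposed by a linear functional. -/
theorem IsFace.exists_real_functional {d : ℕ} {A F : Finset (Fin d → ℤ)} (h : IsFace A F) :
    ∃ f : (Fin d → ℝ) →ₗ[ℝ] ℝ, (∀ v ∈ F, f (fun i => (v i : ℝ)) = 0) ∧
      ∀ v ∈ A, v ∉ F → 0 < f (fun i => (v i : ℝ)) := by
  set e : (Fin d → ℤ) → Fin d → ℝ := fun v i => (v i : ℝ) with he
  obtain ⟨hFA, hface, hmem⟩ := h
  have heA : ∀ v ∈ A, e v ∈ cone A := fun v hv =>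
    PointedCone.subset_hull (Set.mem_image_of_mem _ hv)
  -- The complement of a face in the cone is convex: a point of the face that is a sum with a
  -- positive multiple of x forces x into the face.
  have hconv : Convex ℝ ((cone A : Set (Fin d → ℝ)) \ cone F) := by
    rintro x ⟨hxA, hxF⟩ y ⟨hyA, hyF⟩ a b ha hb hab
    refine ⟨add_mem (PointedCone.smul_mem _ ha hxA) (PointedCone.smul_mem _ hb hyA), ?_⟩
    intro hxy
    rcases ha.eq_or_lt with rfl | ha
    · obtain rfl : b = 1 := by linarith
      exact hyF (by simpa using hxy)
    · exact hxF (hface.mem_of_smul_add_mem hxA (PointedCone.smul_mem _ hb hyA) ha hxy)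
  have hsub : convexHull ℝ (e '' ((A : Set (Fin d → ℤ)) \ F)) ⊆
      (cone A : Set (Fin d → ℝ)) \ cone F := by
    refine convexHull_min ?_ hconv
    rintro _ ⟨v, ⟨hvA, hvF⟩, rfl⟩
    exact ⟨heA v hvA, fun hv => hvF (hmem v hvA hv)⟩
  have hdisj : Disjoint (convexHull ℝ (e '' ((A : Set (Fin d → ℤ)) \ F)))
      (Submodule.span ℝ (e '' (F : Set (Fin d → ℤ))) : Set (Fin d → ℝ)) := by
    rw [Set.disjoint_left]
    intro x hx hxs
    obtain ⟨p, hp, q, hq, hpq⟩ := exists_sub_of_mem_span hxs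
    refine (hsub hx).2 (hface.mem_of_smul_add_mem (hsub hx).1 (hface.le hq) one_pos ?_)
    rw [one_smul, hpq]
    exact hp
  -- The hull of `A \ F` is compact and the span of `F` is closed, so they separate strictly: f < r
  -- < s < 0 on the hull and f > s on the span.
  obtain ⟨f, r, s, hr, hrs, hs⟩ := geometric_hahn_banach_compact_closed
    (convex_convexHull ℝ _)
    (((A.finite_toSet.subset Set.sdiff_subset).image e).isCompact_convexHull ℝ)
    (Submodule.convex _) (Submodule.closed_of_finiteDimensional _) hdisj
  have hs0 : s < 0 := by simpa using hs 0 (zero_mem _)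
  refine ⟨-f.toLinearMap, fun v hv => ?_, fun v hvA hvF => ?_⟩
  · by_contra hne
    have hfv : f (e v) ≠ 0 := fun h0 => hne (by simpa [he] using h0)
    -- A functional bounded below on a subspace vanishes there: otherwise a multiple of `e v`
    -- attains the bound s itself.
    have hsv := hs ((s / f (e v)) • e v) (Submodule.smul_mem _ _
      (Submodule.subset_span (Set.mem_image_of_mem e hv)))
    rw [map_smul, smul_eq_mul, div_mul_cancel₀ _ hfv] at hsv
    exact lt_irrefl _ hsv
  · have := hr (e v) (subset_convexHull ℝ _ (Set.mem_image_of_mem e ⟨hvA, hvF⟩))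
    change 0 < -f (e v)
    linarith

/-- An additive functional `f` on `ℤ^d` with real values that is positive on the finite set `P` can
be replaced by an integral one that is positive on `P` and vanishes wherever `f` does. -/
theorem exists_int_functional {d : ℕ} (f : (Fin d → ℤ) →ₗ[ℤ] ℝ) (P : Finset (Fin d → ℤ))
    (hf : ∀ v ∈ P, 0 < f v) :
    ∃ g : (Fin d → ℤ) →ₗ[ℤ] ℤ, (∀ v, f v = 0 → g v = 0) ∧ ∀ v ∈ P, 0 < g v := by
  -- The range of f is a finitely generated torsion-free group, hence free. Positivity on `P` is an
  -- open condition on the real values of its basis, so these may be moved to rationals and the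
  -- denominators cleared; zeros of f have zero coordinates and stay zeros.
  let b := Module.finBasis ℤ (LinearMap.range f)
  set n := Module.finrank ℤ (LinearMap.range f)
  let c : (Fin d → ℤ) → Fin n → ℤ := fun v => b.repr (f.rangeRestrict v)
  have hc : ∀ v, f v = ∑ j, (c v j : ℝ) * (b j : ℝ) := fun v => by
    have := congrArg (Submodule.subtype _) (b.sum_repr (f.rangeRestrict v))
    rw [map_sum] at this
    simpa [c] using this.symm
  have hopen : IsOpen {y : Fin n → ℝ | ∀ v ∈ P, 0 < ∑ j, (c v j : ℝ) * y j} := by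
    have : {y : Fin n → ℝ | ∀ v ∈ P, 0 < ∑ j, (c v j : ℝ) * y j} =
        ⋂ v ∈ P, {y | 0 < ∑ j, (c v j : ℝ) * y j} := by ext; simp
    rw [this]
    exact isOpen_biInter_finset fun v _ => isOpen_lt continuous_const (by fun_prop)
  obtain ⟨q, hq⟩ := (DenseRange.piMap fun _ : Fin n => Rat.denseRange_cast (𝕜 := ℝ)).exists_mem_open
    hopen ⟨fun j => (b j : ℝ), fun v hv => by rw [← hc]; exact hf v hv⟩
  let D : ℕ := ∏ j, (q j).den
  have hD : 0 < D := Finset.prod_pos fun j _ => (q j).pos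
  have hz : ∀ j, ∃ z : ℤ, (z : ℝ) = D * (q j : ℝ) := fun j => by
    obtain ⟨k, hk⟩ : (q j).den ∣ D := Finset.dvd_prod_of_mem _ (Finset.mem_univ j)
    refine ⟨(q j).num * k, ?_⟩
    rw [hk]
    push_cast
    have h1 : (q j : ℝ) * ((q j).den : ℝ) = (q j).num := by exact_mod_cast Rat.mul_den_eq_num (q j)
    rw [← h1]; ring
  choose z hz using hz
  refine ⟨(b.constr ℤ z).comp f.rangeRestrict, fun v hv => ?_, fun v hv => ?_⟩
  · have : f.rangeRestrict v = 0 := Subtype.ext hv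
    rw [LinearMap.comp_apply, this, map_zero]
  · have h1 : ((((b.constr ℤ z).comp f.rangeRestrict) v : ℤ) : ℝ) =
        D * ∑ j, (c v j : ℝ) * (q j : ℝ) := by
      rw [LinearMap.comp_apply, Module.Basis.constr_apply_fintype]
      simp only [smul_eq_mul, Int.cast_sum, Int.cast_mul, hz, Finset.mul_sum]
      refine Finset.sum_congr rfl fun j _ => ?_
      simp only [c, Module.Basis.equivFun_apply]
      ring
    have h2 : (0 : ℝ) < D * ∑ j, (c v j : ℝ) * (q j : ℝ) :=
      mul_pos (by exact_mod_cast hD) (hq v hv)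
    rw [← h1] at h2
    exact_mod_cast h2

/-- A face of a configuration is exposed by an integer vector. -/
theorem IsFace.exists_functional {d : ℕ} {A F : Finset (Fin d → ℤ)} (h : IsFace A F) :
    ∃ l : Fin d → ℤ, (∀ v ∈ F, l ⬝ᵥ v = 0) ∧ ∀ v ∈ A, v ∉ F → 0 < l ⬝ᵥ v := by
  obtain ⟨f, hf0, hf⟩ := h.exists_real_functional
  let e : (Fin d → ℤ) →ₗ[ℤ] (Fin d → ℝ) :=
    { toFun := fun v i => (v i : ℝ)
      map_add' := fun u v => by ext; simp
      map_smul' := fun c v => by ext; simp }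
  obtain ⟨g, hg0, hg⟩ := exists_int_functional ((f.restrictScalars ℤ).comp e) (A \ F)
    fun v hv => hf v (Finset.mem_sdiff.mp hv).1 (Finset.mem_sdiff.mp hv).2
  have hl : ∀ v, (fun i => g (Pi.single i 1)) ⬝ᵥ v = g v := fun v => by
    conv_rhs => rw [← Finset.univ_sum_single v, map_sum]
    refine Finset.sum_congr rfl fun i _ => ?_
    have : (Pi.single i (v i) : Fin d → ℤ) = v i • Pi.single i 1 := by
      rw [← Pi.single_smul]; simp
    rw [this, map_smul, smul_eq_mul, mul_comm]
  refine ⟨fun i => g (Pi.single i 1), fun v hv => ?_, fun v hvA hvF => ?_⟩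
  · rw [hl]; exact hg0 v (hf0 v hv)
  · rw [hl]; exact hg v (Finset.mem_sdiff.mpr ⟨hvA, hvF⟩)

/-- Its exposing functional is the φ that is positive on all of `A`. -/
theorem StronglyConvex.isFace_empty {d : ℕ} {A : Finset (Fin d → ℤ)} (h : StronglyConvex A)
    (h0 : (0 : Fin d → ℤ) ∉ A) : IsFace A ∅ := by
  have hbot : cone (∅ : Finset (Fin d → ℤ)) = ⊥ := by simp [cone]
  refine ⟨Finset.empty_subset A, ?_, ?_⟩
  · rw [hbot]
    refine ⟨bot_le, fun {x y a} hx hy ha hxy => ?_⟩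
    rw [Submodule.mem_bot] at hxy ⊢
    by_contra hne
    refine h x hx hne ?_
    -- Here a • x + y = 0 with x ≠ 0 would put the line through x in the cone.
    have : -x = a⁻¹ • y := by
      rw [eq_neg_of_add_eq_zero_right hxy, smul_neg, inv_smul_smul₀ ha.ne']
    rw [this]
    exact PointedCone.smul_mem _ (inv_nonneg.mpr ha.le) hy
  · intro v hv hv0
    rw [hbot, Submodule.mem_bot] at hv0
    refine absurd ?_ h0
    have : v = 0 := by
      ext i
      simpa using congrFun hv0 i
    exact this ▸ hv

/-! ### The order on pairs. -/

section Regions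

variable {d : ℕ} {A : Finset (Fin d → ℤ)}

theorem natSpan_mono {F G : Finset (Fin d → ℤ)} (h : F ⊆ G) : natSpan F ≤ natSpan G :=
  AddSubmonoid.closure_mono (Finset.coe_subset.mpr h)

theorem subset_natSpan {F : Finset (Fin d → ℤ)} {v : Fin d → ℤ} (h : v ∈ F) : v ∈ natSpan F :=
  AddSubmonoid.subset_closure h

theorem dotProduct_nonneg_of_mem_natSpan {l : Fin d → ℤ} {F : Finset (Fin d → ℤ)}
    (h : ∀ v ∈ F, 0 ≤ l ⬝ᵥ v) {c : Fin d → ℤ} (hc : c ∈ natSpan F) : 0 ≤ l ⬝ᵥ c := by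
  induction hc using AddSubmonoid.closure_induction with
  | mem v hv => exact h v hv
  | zero => simp
  | add x y _ _ hx hy => rw [dotProduct_add]; exact add_nonneg hx hy

theorem dotProduct_eq_zero_of_mem_natSpan {l : Fin d → ℤ} {F : Finset (Fin d → ℤ)}
    (h : ∀ v ∈ F, l ⬝ᵥ v = 0) {c : Fin d → ℤ} (hc : c ∈ natSpan F) : l ⬝ᵥ c = 0 := by
  induction hc using AddSubmonoid.closure_induction with
  | mem v hv => exact h v hv
  | zero => simp
  | add x y _ _ hx hy => rw [dotProduct_add, hx, hy, add_zero]

theorem eq_zero_of_mem_natSpan {l : Fin d → ℤ} {F : Finset (Fin d → ℤ)}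
    (h : ∀ v ∈ F, 0 < l ⬝ᵥ v) {c : Fin d → ℤ} (hc : c ∈ natSpan F) : l ⬝ᵥ c = 0 → c = 0 := by
  induction hc using AddSubmonoid.closure_induction with
  | mem v hv => exact fun h0 => absurd h0 (h v hv).ne'
  | zero => exact fun _ => rfl
  | add x y hx hy ihx ihy =>
    intro h0
    rw [dotProduct_add] at h0
    have h1 := dotProduct_nonneg_of_mem_natSpan (fun v hv => (h v hv).le) hx
    have h2 := dotProduct_nonneg_of_mem_natSpan (fun v hv => (h v hv).le) hy
    rw [ihx (by omega), ihy (by omega), add_zero]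

theorem exists_natSpan_sdiff_add {G : Finset (Fin d → ℤ)} (hG : G ⊆ A) {a : Fin d → ℤ}
    (ha : a ∈ natSpan A) : ∃ m ∈ natSpan (A \ G), ∃ g ∈ natSpan G, m + g = a := by
  have : natSpan A = natSpan (A \ G) ⊔ natSpan G := by
    rw [← AddSubmonoid.closure_union, ← Finset.coe_union, Finset.sdiff_union_of_subset hG]
  exact AddSubmonoid.mem_sup.mp (this ▸ ha)

theorem dotProduct_eq_of_mem_region {l : Fin d → ℤ} {p : Pair d} (h : ∀ v ∈ p.2, l ⬝ᵥ v = 0)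
    {a : Fin d → ℤ} (ha : a ∈ region p) : l ⬝ᵥ a = l ⬝ᵥ p.1 := by
  obtain ⟨c, hc, rfl⟩ := ha
  rw [dotProduct_add, dotProduct_eq_zero_of_mem_natSpan h hc, add_zero]

theorem add_mem_region {p : Pair d} {a c : Fin d → ℤ} (ha : a ∈ region p)
    (hc : c ∈ natSpan p.2) : a + c ∈ region p := by
  obtain ⟨c', hc', rfl⟩ := ha
  exact ⟨c' + c, add_mem hc' hc, add_assoc _ _ _⟩

theorem fst_mem_region (p : Pair d) : p.1 ∈ region p := ⟨0, zero_mem _, (add_zero _).symm⟩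

theorem dotProduct_nonneg_of_exposes {F : Finset (Fin d → ℤ)} {l : Fin d → ℤ}
    (h0 : ∀ v ∈ F, l ⬝ᵥ v = 0) (h1 : ∀ v ∈ A, v ∉ F → 0 < l ⬝ᵥ v) :
    ∀ v ∈ A, 0 ≤ l ⬝ᵥ v := fun v hv => by
  by_cases hvF : v ∈ F
  · exact (h0 v hvF).ge
  · exact (h1 v hv hvF).le

/-- A functional exposing `q.2` is constant on `region q`, so it must vanish on every direction of
`p.2`; this puts `p.2` inside `q.2`. -/
theorem prec_iff {p q : Pair d} (hp : IsPair A p) (hq : IsPair A q) :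
    Prec p q ↔ p.2 ⊆ q.2 ∧ p.1 ∈ region q := by
  constructor
  · intro h
    obtain ⟨l, h0, h1⟩ := hq.2.exists_functional
    refine ⟨fun v hv => ?_, h (fst_mem_region p)⟩
    by_contra hvq
    have e1 := dotProduct_eq_of_mem_region h0 (h (fst_mem_region p))
    have e2 := dotProduct_eq_of_mem_region h0
      (h (add_mem_region (fst_mem_region p) (subset_natSpan hv)))
    have := h1 v (hp.2.1 hv) hvq
    rw [dotProduct_add] at e2
    omega
  · rintro ⟨hF, ha⟩ _ ⟨c, hc, rfl⟩
    exact add_mem_region ha (natSpan_mono hF hc)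

theorem prec_antisymm {φ : Fin d → ℤ} (hφ : ∀ v ∈ A, 0 < φ ⬝ᵥ v) {p q : Pair d}
    (hp : IsPair A p) (hq : IsPair A q) (hpq : Prec p q) (hqp : Prec q p) : p = q := by
  obtain ⟨h1, c, hc, hpc⟩ := (prec_iff hp hq).mp hpq
  obtain ⟨h2, e, he, hqe⟩ := (prec_iff hq hp).mp hqp
  have hφq : ∀ v ∈ q.2, 0 < φ ⬝ᵥ v := fun v hv => hφ v (hq.2.1 hv)
  have hφp : ∀ v ∈ p.2, 0 < φ ⬝ᵥ v := fun v hv => hφ v (hp.2.1 hv)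
  have n1 := dotProduct_nonneg_of_mem_natSpan (fun v hv => (hφq v hv).le) hc
  have n2 := dotProduct_nonneg_of_mem_natSpan (fun v hv => (hφp v hv).le) he
  have e1 := congrArg (φ ⬝ᵥ ·) hpc
  have e2 := congrArg (φ ⬝ᵥ ·) hqe
  simp only [dotProduct_add] at e1 e2
  have : c = 0 := eq_zero_of_mem_natSpan hφq hc (by omega)
  refine Prod.ext ?_ (h1.antisymm h2)
  rw [hpc, this, add_zero]

end Regions

/-! ### Proper pairs and covers. -/

section Proper

variable {𝕜 : Type u} [Field 𝕜] {d : ℕ} {A : Finset (Fin d → ℤ)}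
  {I : Ideal (SemigroupRing 𝕜 A)} {C : Finset (Pair d)}

theorem mem_stdMono_of_add {a c : Fin d → ℤ} (ha : a ∈ natSpan A) (hc : c ∈ natSpan A)
    (h : a + c ∈ stdMono I) : a ∈ stdMono I := by
  obtain ⟨hac, hI⟩ := h
  refine ⟨ha, fun hmem => hI ?_⟩
  have := I.mul_mem_right (AddMonoidAlgebra.single (⟨c, hc⟩ : natSpan A) (1 : 𝕜)) hmem
  rwa [AddMonoidAlgebra.single_mul_single, one_mul] at this

theorem IsCover.region_subset (hC : IsCover I C) {q : Pair d} (hq : q ∈ C) :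
    region q ⊆ stdMono I := by
  rw [hC.2]
  exact Set.subset_biUnion_of_mem (u := region) hq

/-- Each point of `region p`, once shifted by f, lies in `region q` and is standard; removing the
summand f keeps it standard. -/
theorem IsCover.isProperPair_of_add_mem (hC : IsCover I C) {q : Pair d} (hq : q ∈ C)
    {p : Pair d} (hp : IsPair A p) (hpq : p.2 ⊆ q.2) {f : Fin d → ℤ} (hf : f ∈ natSpan q.2)
    (h : p.1 + f ∈ region q) : IsProperPair I p := by
  have hqA := (hC.1 q hq).2.1
  refine ⟨hp, ?_⟩
  rintro _ ⟨c, hc, rfl⟩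
  refine mem_stdMono_of_add (c := f) (add_mem hp.1 (natSpan_mono hp.2.1 hc))
    (natSpan_mono hqA hf) ?_
  rw [add_right_comm]
  exact hC.region_subset hq (add_mem_region h (natSpan_mono hpq hc))

theorem IsCover.exists_add_mem (hC : IsCover I C) {p : Pair d} (hp : IsProperPair I p) :
    ∃ q ∈ C, p.2 ⊆ q.2 ∧ ∃ f ∈ natSpan p.2, p.1 + f ∈ region q := by
  set s : Fin d → ℤ := ∑ v ∈ p.2, v with hs
  have hsp : ∀ N : ℕ, N • s ∈ natSpan p.2 := fun N =>
    nsmul_mem (sum_mem fun v hv => subset_natSpan hv) N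
  have hex : ∀ N : ℕ, ∃ q : C, p.1 + N • s ∈ region q.1 := fun N => by
    have := hp.2 (add_mem_region (fst_mem_region p) (hsp N))
    rw [hC.2] at this
    simpa using this
  choose Q hQ using hex
  -- Infinitely many N, finitely many pairs in the cover.
  obtain ⟨N, N', hne, heq⟩ := Finite.exists_ne_map_eq_of_infinite Q
  have hN := hQ N
  have hN' := hQ N'
  rw [← heq] at hN'
  refine ⟨(Q N).1, (Q N).2, fun v hv => ?_, N • s, hsp N, hN⟩
  obtain ⟨l, h0, h1⟩ := (hC.1 _ (Q N).2).2.exists_functional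
  have e1 := dotProduct_eq_of_mem_region h0 hN
  have e2 := dotProduct_eq_of_mem_region h0 hN'
  simp only [dotProduct_add, dotProduct_smul] at e1 e2
  simp only [nsmul_eq_mul] at e1 e2
  -- As l is constant on the common region, it kills s; the terms l·v of this sum are nonnegative,
  -- so each is zero.
  have hls : l ⬝ᵥ s = 0 := by
    have : ((N : ℤ) - N') * (l ⬝ᵥ s) = 0 := by linarith
    rcases mul_eq_zero.mp this with h | h
    · exact absurd (by omega) hne
    · exact h
  rw [hs, dotProduct_sum, Finset.sum_eq_zero_iff_of_nonneg fun v hv =>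
    dotProduct_nonneg_of_exposes h0 h1 v (hp.1.2.1 hv)] at hls
  by_contra hvq
  exact (h1 v (hp.1.2.1 hv) hvq).ne' (hls v hv)

/-- Every proper pair lies below a proper pair `(m, G)` where `G` is a face of the cover and `m` is
a sum of elements outside `G`; the size of `m` is determined by the cover. -/
theorem IsCover.exists_prec (hC : IsCover I C) {p : Pair d} (hp : IsProperPair I p) :
    ∃ q ∈ C, ∃ m ∈ natSpan (A \ q.2), IsProperPair I (m, q.2) ∧ Prec p (m, q.2) ∧
      ∀ l : Fin d → ℤ, (∀ v ∈ q.2, l ⬝ᵥ v = 0) → l ⬝ᵥ m = l ⬝ᵥ q.1 := by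
  obtain ⟨q, hq, hpq, f, hf, hmem⟩ := hC.exists_add_mem hp
  have hface := (hC.1 q hq).2
  obtain ⟨m, hm, g, hg, hmg⟩ := exists_natSpan_sdiff_add hface.1 hp.1.1
  have hpair : IsPair A (m, q.2) := ⟨natSpan_mono Finset.sdiff_subset hm, hface⟩
  -- Write p.1 = m + g with g ∈ ℕG. Then g joins f as a shift along G, and l·m is read off from m +
  -- (g + f) ∈ `region q`.
  have hgf : g + f ∈ natSpan q.2 := add_mem hg (natSpan_mono hpq hf)
  have hmem' : m + (g + f) ∈ region q := by rwa [← add_assoc, hmg]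
  refine ⟨q, hq, m, hm, hC.isProperPair_of_add_mem hq hpair subset_rfl hgf hmem', ?_, ?_⟩
  · exact (prec_iff hp.1 hpair).mpr ⟨hpq, g, hg, hmg.symm⟩
  · intro l hl
    rw [← dotProduct_eq_of_mem_region hl hmem', dotProduct_add,
      dotProduct_eq_zero_of_mem_natSpan hl hgf, add_zero]

end Proper

/-! ### Coordinate lists and bounded sums. -/

section Codes

variable {d : ℕ}

/-- The vector whose coordinates are the first `d` entries of `l`, padded by zeros. -/
def listVec (d : ℕ) (l : List ℤ) : Fin d → ℤ := fun i => l.getD i 0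

theorem listVec_ofFn (v : Fin d → ℤ) : listVec d (List.ofFn v) = v := by
  ext i; simp [listVec]

theorem vecAdd_ofFn (u v : Fin d → ℤ) :
    vecAdd (List.ofFn u) (List.ofFn v) = List.ofFn (u + v) := by
  induction d with
  | zero => simp [vecAdd]
  | succ d ih =>
    have := ih (fun i => u i.succ) (fun i => v i.succ)
    simp only [vecAdd, List.ofFn_succ, List.zipWith_cons_cons] at this ⊢
    rw [this]; rfl

theorem dot_ofFn (l : List ℤ) (v : Fin d → ℤ) :
    dot l (List.ofFn v) = listVec d l ⬝ᵥ v := by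
  induction d generalizing l with
  | zero => simp [dot]
  | succ d ih =>
    cases l with
    | nil => simp [dot, listVec, dotProduct]
    | cons a l =>
      have := ih l (fun i => v i.succ)
      simp only [dot, List.ofFn_succ, List.zipWith_cons_cons, List.foldr_cons] at this ⊢
      rw [this]
      simp [dotProduct, listVec, Fin.sum_univ_succ]

theorem CodesVecs.ofFn_mem_iff {g : VecListCode} {G : Finset (Fin d → ℤ)} (h : CodesVecs g G)
    {v : Fin d → ℤ} : List.ofFn v ∈ g ↔ v ∈ G := by
  constructor
  · intro hv
    obtain ⟨w, hw, hvw⟩ := h.1 _ hv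
    rw [List.ofFn_injective hvw]
    exact hw
  · intro hv
    obtain ⟨x, hx, rfl⟩ := h.2 v hv
    exact hx

theorem CodesVecs.subset_iff {f g : VecListCode} {F G : Finset (Fin d → ℤ)}
    (hf : CodesVecs f F) (hg : CodesVecs g G) : f ⊆ g ↔ F ⊆ G := by
  constructor
  · intro h v hv
    exact hg.ofFn_mem_iff.mp (h (hf.ofFn_mem_iff.mpr hv))
  · intro h x hx
    obtain ⟨v, hv, rfl⟩ := hf.1 x hx
    exact hg.ofFn_mem_iff.mpr (h hv)

theorem self_mem_reach (g : VecListCode) (b : List ℤ) (k : ℕ) : b ∈ reach g b k := by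
  induction k with
  | zero => simp [reach]
  | succ k ih => exact List.mem_append_left _ ih

theorem CodesVecs.exists_of_mem_reach {g : VecListCode} {G : Finset (Fin d → ℤ)}
    (hg : CodesVecs g G) {b : Fin d → ℤ} {k : ℕ} {x : List ℤ}
    (hx : x ∈ reach g (List.ofFn b) k) : ∃ c ∈ natSpan G, x = List.ofFn (b + c) := by
  induction k generalizing x with
  | zero => exact ⟨0, zero_mem _, by simpa [reach] using hx⟩
  | succ k ih =>
    rcases List.mem_append.mp hx with hx | hx
    · exact ih hx
    · obtain ⟨y, hy, hxy⟩ := List.mem_flatMap.mp hx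
      obtain ⟨w, hw, rfl⟩ := List.mem_map.mp hxy
      obtain ⟨c, hc, rfl⟩ := ih hy
      obtain ⟨v, hv, rfl⟩ := hg.1 w hw
      exact ⟨c + v, add_mem hc (subset_natSpan hv), by rw [vecAdd_ofFn, add_assoc]⟩

/-- Every summand raises the integer functional l by at least 1, so c has at most l·c summands. -/
theorem mem_reach {g : VecListCode} {G : Finset (Fin d → ℤ)} (hg : ∀ v ∈ G, List.ofFn v ∈ g)
    {l : Fin d → ℤ} (hl : ∀ v ∈ G, 0 < l ⬝ᵥ v) (b : Fin d → ℤ) {c : Fin d → ℤ}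
    (hc : c ∈ natSpan G) {k : ℕ} (hk : (l ⬝ᵥ c).toNat ≤ k) :
    List.ofFn (b + c) ∈ reach g (List.ofFn b) k := by
  induction hc using AddSubmonoid.closure_induction_right generalizing k with
  | zero => rw [add_zero]; exact self_mem_reach _ _ _
  | add_right x hx v hv ih =>
    have h1 := dotProduct_nonneg_of_mem_natSpan (fun v hv => (hl v hv).le) hx
    have h2 := hl v hv
    rw [dotProduct_add] at hk
    obtain ⟨k, rfl⟩ : ∃ k', k = k' + 1 := ⟨k - 1, by omega⟩
    refine List.mem_append_right _ (List.mem_flatMap.mpr ⟨_, ih (k := k) (by omega), ?_⟩)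
    exact List.mem_map.mpr ⟨_, hg v hv, by rw [vecAdd_ofFn, add_assoc]⟩

/-- If y = b + c with b ∈ ℕA, then φ·c ≤ φ·y, so φ·y steps suffice. -/
theorem memShift_iff {A : Finset (Fin d → ℤ)} {φ : List ℤ}
    (hφ : ∀ v ∈ A, 0 < listVec d φ ⬝ᵥ v) {g : VecListCode} {p : Pair d} (hp : IsPair A p)
    (hg : CodesVecs g p.2) (y : Fin d → ℤ) :
    MemShift φ (List.ofFn y) (List.ofFn p.1) g ↔ y ∈ region p := by
  constructor
  · intro h
    obtain ⟨c, hc, hyc⟩ := hg.exists_of_mem_reach h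
    exact ⟨c, hc, List.ofFn_injective hyc⟩
  · rintro ⟨c, hc, rfl⟩
    refine mem_reach (l := listVec d φ) (fun v hv => hg.ofFn_mem_iff.mpr hv)
      (fun v hv => hφ v (hp.2.1 hv)) _ hc ?_
    have := dotProduct_nonneg_of_mem_natSpan (fun v hv => (hφ v hv).le) hp.1
    rw [dot_ofFn, dotProduct_add]
    omega

end Codes

/-! ### Existence and correctness of certificates. -/

section Search

variable {𝕜 : Type u} [Field 𝕜] {d : ℕ} {A : Finset (Fin d → ℤ)}
  {I : Ideal (SemigroupRing 𝕜 A)} {C : Finset (Pair d)}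
  {codeA : VecListCode} {codeC : PairListCode} {φ : List ℤ}

theorem exists_of_mem_candidates (hA : CodesVecs codeA A) (hC : IsCover I C)
    (hcC : CodesPairs codeC (C : Set (Pair d))) {N : ℕ} {x : List ℤ × VecListCode}
    (hx : x ∈ candidates codeA codeC N) : ∃ p, IsPair A p ∧ CodesPair x p := by
  obtain ⟨y, hy, hxy⟩ := List.mem_flatMap.mp hx
  obtain ⟨z, hz, rfl⟩ := List.mem_map.mp hxy
  obtain ⟨q, hq, hq1, hq2⟩ := hcC.1 y hy
  -- The input does not contain d; the length of the zero vector comes from the pair.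
  have h0 : y.1.map (fun _ => (0 : ℤ)) = List.ofFn (0 : Fin d → ℤ) := by
    rw [hq1, List.map_ofFn]; rfl
  rw [h0] at hz
  obtain ⟨c, hc, rfl⟩ := hA.exists_of_mem_reach hz
  rw [zero_add]
  exact ⟨(c, q.2), ⟨hc, (hC.1 q hq).2⟩, rfl, hq2⟩

theorem mem_candidates (hA : CodesVecs codeA A) {q : Pair d} {y : List ℤ × VecListCode}
    (hy : y ∈ codeC) (hyq : CodesPair y q) {l : Fin d → ℤ}
    (hl : ∀ v ∈ A, v ∉ q.2 → 0 < l ⬝ᵥ v) {m : Fin d → ℤ} (hm : m ∈ natSpan (A \ q.2)) {N : ℕ}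
    (hN : (l ⬝ᵥ m).toNat ≤ N) : (List.ofFn m, y.2) ∈ candidates codeA codeC N := by
  refine List.mem_flatMap.mpr ⟨y, hy, List.mem_map.mpr ⟨_, ?_, rfl⟩⟩
  have h0 : y.1.map (fun _ => (0 : ℤ)) = List.ofFn (0 : Fin d → ℤ) := by
    rw [hyq.1, List.map_ofFn]; rfl
  rw [h0]
  have := mem_reach (g := codeA) (G := A \ q.2)
    (fun v hv => hA.ofFn_mem_iff.mpr (Finset.mem_sdiff.mp hv).1)
    (fun v hv => hl v (Finset.mem_sdiff.mp hv).1 (Finset.mem_sdiff.mp hv).2) 0 hm hN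
  rwa [zero_add] at this

theorem exists_memShift_iff (hC : IsCover I C) (hcC : CodesPairs codeC (C : Set (Pair d)))
    (hφ : ∀ v ∈ A, 0 < listVec d φ ⬝ᵥ v) (y : Fin d → ℤ) :
    (∃ p ∈ codeC, MemShift φ (List.ofFn y) p.1 p.2) ↔ y ∈ stdMono I := by
  rw [hC.2]
  simp only [Set.mem_iUnion, exists_prop]
  constructor
  · rintro ⟨x, hx, h⟩
    obtain ⟨q, hq, hq1, hq2⟩ := hcC.1 x hx
    rw [hq1, memShift_iff hφ (hC.1 q hq) hq2] at h
    exact ⟨q, hq, h⟩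
  · rintro ⟨q, hq, h⟩
    obtain ⟨x, hx, hq1, hq2⟩ := hcC.2 q hq
    refine ⟨x, hx, ?_⟩
    rw [hq1, memShift_iff hφ (hC.1 q hq) hq2]
    exact h

theorem ProperWit.isProperPair (hC : IsCover I C) (hcC : CodesPairs codeC (C : Set (Pair d)))
    (hφ : ∀ v ∈ A, 0 < listVec d φ ⬝ᵥ v) {x : List ℤ × VecListCode} {p : Pair d}
    (hp : IsPair A p) (hxp : CodesPair x p) {k : ℕ} (h : ProperWit φ codeC k x) :
    IsProperPair I p := by
  obtain ⟨y, hy, z, hz, hsub, hmem⟩ := h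
  obtain ⟨q, hq, hq1, hq2⟩ := hcC.1 z hz
  rw [hxp.1] at hy
  obtain ⟨c, hc, rfl⟩ := hxp.2.exists_of_mem_reach hy
  rw [hq1, memShift_iff hφ (hC.1 q hq) hq2] at hmem
  have hpq := (hxp.2.subset_iff hq2).mp hsub
  exact hC.isProperPair_of_add_mem hq hp hpq (natSpan_mono hpq hc) hmem

theorem ImproperWit.not_isProperPair (hC : IsCover I C)
    (hcC : CodesPairs codeC (C : Set (Pair d))) (hφ : ∀ v ∈ A, 0 < listVec d φ ⬝ᵥ v)
    {x : List ℤ × VecListCode} {p : Pair d} (hxp : CodesPair x p) {k : ℕ}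
    (h : ImproperWit φ codeC k x) : ¬ IsProperPair I p := by
  obtain ⟨y, hy, hno⟩ := h
  rw [hxp.1] at hy
  obtain ⟨c, hc, rfl⟩ := hxp.2.exists_of_mem_reach hy
  rw [exists_memShift_iff hC hcC hφ] at hno
  exact fun hp => hno (hp.2 ⟨c, hc, rfl⟩)

/-- Properness and its failure are each witnessed by one f ∈ ℕF, and f is reached after φ·f steps.
-/
theorem eventually_properWit_or (hC : IsCover I C) (hcC : CodesPairs codeC (C : Set (Pair d)))
    (hφ : ∀ v ∈ A, 0 < listVec d φ ⬝ᵥ v) {x : List ℤ × VecListCode} {p : Pair d}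
    (hp : IsPair A p) (hxp : CodesPair x p) :
    ∀ᶠ k in Filter.atTop, ProperWit φ codeC k x ∨ ImproperWit φ codeC k x := by
  have hreach : ∀ {f : Fin d → ℤ}, f ∈ natSpan p.2 → ∀ k ≥ (listVec d φ ⬝ᵥ f).toNat,
      List.ofFn (p.1 + f) ∈ reach x.2 x.1 k := fun hf k hk => by
    rw [hxp.1]
    exact mem_reach (fun v hv => hxp.2.ofFn_mem_iff.mpr hv) (fun v hv => hφ v (hp.2.1 hv)) _ hf hk
  by_cases hprop : IsProperPair I p
  · obtain ⟨q, hq, hpq, f, hf, hmem⟩ := hC.exists_add_mem hprop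
    obtain ⟨z, hz, hq1, hq2⟩ := hcC.2 q hq
    filter_upwards [Filter.eventually_ge_atTop (listVec d φ ⬝ᵥ f).toNat] with k hk
    refine Or.inl ⟨_, hreach hf k hk, z, hz, (hxp.2.subset_iff hq2).mpr hpq, ?_⟩
    rw [hq1, memShift_iff hφ (hC.1 q hq) hq2]
    exact hmem
  · obtain ⟨_, ⟨f, hf, rfl⟩, hno⟩ := Set.not_subset.mp fun h => hprop ⟨hp, h⟩
    filter_upwards [Filter.eventually_ge_atTop (listVec d φ ⬝ᵥ f).toNat] with k hk
    refine Or.inr ⟨_, hreach hf k hk, ?_⟩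
    rwa [exists_memShift_iff hC hcC hφ]

theorem exists_valid (h0 : (0 : Fin d → ℤ) ∉ A) (hconv : StronglyConvex A) (hC : IsCover I C)
    (hA : CodesVecs codeA A) (hcC : CodesPairs codeC (C : Set (Pair d))) :
    ∃ Z, Valid codeA codeC Z := by
  obtain ⟨φ, -, hφ⟩ := (hconv.isFace_empty h0).exists_functional
  replace hφ : ∀ v ∈ A, 0 < listVec d (List.ofFn φ) ⬝ᵥ v := fun v hv => by
    rw [listVec_ofFn]
    exact hφ v hv (Finset.notMem_empty v)
  have hl : ∀ y ∈ codeC, ∃ l, Exposes codeA l y.2 := fun y hy => by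
    obtain ⟨q, hq, hq1, hq2⟩ := hcC.1 y hy
    obtain ⟨l, hl0, hl1⟩ := (hC.1 q hq).2.exists_functional
    refine ⟨List.ofFn l, fun w hw => ?_⟩
    obtain ⟨v, hv, rfl⟩ := hA.1 w hw
    rw [hq2.ofFn_mem_iff, dot_ofFn, listVec_ofFn]
    by_cases hvq : v ∈ q.2
    · exact Or.inl ⟨hvq, hl0 v hvq⟩
    · exact Or.inr ⟨hvq, by have := hl1 v hv hvq; omega⟩
  choose! l hl using hl
  obtain ⟨N, hN⟩ : ∃ N, ∀ y ∈ codeC, (dot (l y) y.1).toNat ≤ N :=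
    ((Filter.eventually_all_finite (List.finite_toSet codeC)).mpr fun y _ =>
      Filter.eventually_ge_atTop (dot (l y) y.1).toNat).exists
  -- One k serves all of the finitely many candidates.
  obtain ⟨k, hk⟩ := ((Filter.eventually_all_finite
    (List.finite_toSet (candidates codeA codeC N))).mpr fun x hx => by
      obtain ⟨p, hp, hxp⟩ := exists_of_mem_candidates hA hC hcC hx
      exact eventually_properWit_or hC hcC hφ hp hxp).exists
  refine ⟨(N, k, List.ofFn φ, codeC.map l), fun w hw => ?_, fun y hy => ?_, hk⟩
  · obtain ⟨v, hv, rfl⟩ := hA.1 w hw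
    have := hφ v hv
    rw [← dot_ofFn] at this
    change 0 < (dot (List.ofFn φ) (List.ofFn v)).toNat
    omega
  · exact ⟨l y, List.mem_map_of_mem hy, hl y hy, hN y hy⟩

theorem codesPairs_output (hC : IsCover I C) (hA : CodesVecs codeA A)
    (hcC : CodesPairs codeC (C : Set (Pair d))) {Z : Certificate} (hZ : Valid codeA codeC Z) :
    CodesPairs (output codeA codeC Z) (stdPairs I) := by
  obtain ⟨N, k, φ, Λ⟩ := Z
  obtain ⟨hφ, hΛ, hk⟩ := hZ
  replace hφ : ∀ v ∈ A, 0 < listVec d φ ⬝ᵥ v := fun v hv => by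
    have := hφ _ (hA.ofFn_mem_iff.mpr hv)
    rw [dot_ofFn] at this
    exact Int.pos_iff_toNat_pos.mpr this
  have hwit : ∀ {x p}, x ∈ candidates codeA codeC N → CodesPair x p → IsProperPair I p →
      ProperWit φ codeC k x := fun hx hxp hp =>
    (hk _ hx).resolve_right fun h => h.not_isProperPair hC hcC hφ hxp hp
  -- Every proper pair lies below a proper candidate, so maximality need only be tested against
  -- candidates.
  have hcand : ∀ {p}, IsProperPair I p → ∃ p', IsProperPair I p' ∧ Prec p p' ∧
      ∃ x ∈ candidates codeA codeC N, CodesPair x p' := fun hp => by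
    obtain ⟨q, hq, m, hm, hmq, hprec, hdot⟩ := hC.exists_prec hp
    obtain ⟨y, hy, hyq⟩ := hcC.2 q hq
    obtain ⟨l, -, hl, hlN⟩ := hΛ y hy
    have hl' : ∀ v ∈ A, v ∈ q.2 ∧ listVec d l ⬝ᵥ v = 0 ∨ v ∉ q.2 ∧ 0 < listVec d l ⬝ᵥ v :=
      fun v hv => by
        have := hl _ (hA.ofFn_mem_iff.mpr hv)
        rw [hyq.2.ofFn_mem_iff, dot_ofFn] at this
        exact this.imp_right fun h => ⟨h.1, by omega⟩
    rw [hyq.1, dot_ofFn] at hlN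
    refine ⟨(m, q.2), hmq, hprec, _, mem_candidates (l := listVec d l) hA hy hyq ?_ hm ?_,
      rfl, hyq.2⟩
    · exact fun v hv hvq => ((hl' v hv).resolve_left fun h => hvq h.1).2
    · rwa [hdot _ fun v hv => ((hl' v ((hC.1 q hq).2.1 hv)).resolve_right fun h => h.1 hv).2]
  have hsel : ∀ {x p}, x ∈ candidates codeA codeC N → IsPair A p → CodesPair x p →
      (Selected codeA codeC (N, k, φ, Λ) x ↔ p ∈ stdPairs I) := by
    intro x p hx hp hxp
    constructor
    · rintro ⟨hpw, hmax⟩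
      refine ⟨hpw.isProperPair hC hcC hφ hp hxp, fun q hq hpq => ?_⟩
      -- Enlarge q to a candidate q'. Then p ≺ q ≺ q', selection forces q' = p, and antisymmetry
      -- gives q = p.
      obtain ⟨q', hq', hqq', y, hy, hyq'⟩ := hcand hq
      obtain ⟨hsub, hmem⟩ := (prec_iff hp hq'.1).mp (hpq.trans hqq')
      obtain ⟨h1, h2⟩ := hmax y hy (hwit hy hyq' hq')
        ⟨(hxp.2.subset_iff hyq'.2).mpr hsub, by
          rw [hxp.1, hyq'.1, memShift_iff hφ hq'.1 hyq'.2]; exact hmem⟩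
      have he : q' = p := by
        refine Prod.ext ?_ (((hyq'.2.subset_iff hxp.2).mp h2).antisymm hsub)
        rw [hyq'.1, hxp.1] at h1
        exact List.ofFn_injective h1
      exact prec_antisymm hφ hq.1 hp (he ▸ hqq') hpq
    · rintro ⟨hprop, hmax⟩
      refine ⟨hwit hx hxp hprop, fun y hy hyw hxy => ?_⟩
      obtain ⟨q, hq, hyq⟩ := exists_of_mem_candidates hA hC hcC hy
      obtain ⟨hsub, hmem⟩ := hxy
      rw [hxp.1, hyq.1, memShift_iff hφ hq hyq.2] at hmem
      have he := hmax q (hyw.isProperPair hC hcC hφ hq hyq)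
        ((prec_iff hp hq).mpr ⟨(hxp.2.subset_iff hyq.2).mp hsub, hmem⟩)
      subst he
      exact ⟨hyq.1.trans hxp.1.symm, (hyq.2.subset_iff hxp.2).mpr subset_rfl⟩
  constructor
  · intro x hx
    simp only [output, List.mem_filter, decide_eq_true_eq] at hx
    obtain ⟨p, hp, hxp⟩ := exists_of_mem_candidates hA hC hcC hx.1
    exact ⟨p, (hsel hx.1 hp hxp).mp hx.2, hxp⟩
  · intro p hp
    obtain ⟨p', hp', hprec, x, hx, hxp'⟩ := hcand hp.1
    -- A standard pair equals the candidate above it.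
    obtain rfl := hp.2 p' hp' hprec
    refine ⟨x, ?_, hxp'⟩
    simp only [output, List.mem_filter, decide_eq_true_eq]
    exact ⟨hx, (hsel hx hp'.1 hxp').mpr hp⟩

end Search

end StdPairs

/-- There is one algorithm (a partial recursive function) which, for every configuration `A` with
strongly convex cone, every monomial ideal `I` of `𝕜[ℕA]` and every cover `C` of its standard
monomials, halts on the input `(A, C)` and outputs the set of standard pairs of `I`. -/
theorem mainTheorem9 :
    ∃ alg : StdPairs.VecListCode × StdPairs.PairListCode →. StdPairs.PairListCode,
      Partrec alg ∧
      ∀ (d : ℕ) (A : Finset (Fin d → ℤ)), (0 : Fin d → ℤ) ∉ A → StdPairs.StronglyConvex A →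
      ∀ (𝕜 : Type u) [Field 𝕜] (I : Ideal (StdPairs.SemigroupRing 𝕜 A)),
        StdPairs.IsMonomialIdeal I →
      ∀ C : Finset (StdPairs.Pair d), StdPairs.IsCover I C →
      ∀ (codeA : StdPairs.VecListCode) (codeC : StdPairs.PairListCode),
        StdPairs.CodesVecs codeA A → StdPairs.CodesPairs codeC (C : Set (StdPairs.Pair d)) →
        ∃ out ∈ alg (codeA, codeC), StdPairs.CodesPairs out (StdPairs.stdPairs I) := by
  obtain ⟨alg, halg, hspec⟩ := StdPairs.exists_partrec_search
  refine ⟨alg, halg, fun d A h0 hconv 𝕜 _ I _ C hC codeA codeC hA hcC => ?_⟩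
  obtain ⟨Z, hZ, hmem⟩ := hspec codeA codeC (StdPairs.exists_valid h0 hconv hC hA hcC)
  exact ⟨_, hmem, StdPairs.codesPairs_output hC hA hcC hZ⟩
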